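/- Let $q$ be a prime power, let $n\ge 1$ and $s\ge 0$ be integers with $\gcd(s,n)=1$, and put $\sigma=q^s$. Let $f(x)=\sum_{i=0}^{n-1}a_ix^{\sigma^i}\in\mathbb F_{q^n}[x]$, regarded as an $\mathbb F_q$-linear transformation of $\mathbb F_{q^n}$, so that $\ker f=\{x\in\mathbb F_{q^n}: f(x)=0\}$ is an $\mathbb F_q$-subspace; denote its dimension by $\dim_q(\ker f)$. Let $D_\sigma(f)$ be the $n\times n$ matrix, with rows and columns indexed from $0$ to $n-1$, whose $(i,j)$ entry is $a_{(j-i)\bmod n}^{\sigma^i}$, and for $m\ge 0$ let $D_{m,\sigma}(f)$ be the $(n-m)\times(n-m)$ matrix obtained from $D_\sigma(f)$ by removing its first $m$ columns and its last $m$ rows (for $m\ge n$ this is the empty matrix, of determinant $1$). Write $|M|$ for the determinant of a matrix $M$. (i) For every integer $\mu\ge 0$, $\dim_q(\ker f)=\mu$ if and only if $$|D_{0,\sigma}(f)|=|D_{1,\sigma}(f)|=\dots=|D_{\mu-1,\sigma}(f)|=0\quad\text{and}\quad |D_{\mu,\sigma}(f)|\ne 0.$$ (ii) Let $0\le m\le\dim_q(\ker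 f)$, and let $J,K\subseteq\{0,1,\dots,n-1\}$ be two sets, each consisting of $m$ integers that are consecutive modulo $n$. Let $M_{J,K}(f)$ be the $(n-m)\times(n-m)$ matrix obtained from $D_\sigma(f)$ by removing its rows with indices in $J$ and its columns with indices in $K$. Then $$|M_{J,K}(f)|=0\iff |D_{m,\sigma}(f)|=0.$$ -/

import Mathlib

/-- The `σ`-polynomial `∑ i, a i * x ^ (σ ^ i)`, for coefficients `a 0, …, a (n - 1)`. -/
noncomputable def sigmaPoly {K : Type*} [Field K] {n : ℕ} (σ : ℕ) (a : Fin n → K) : Polynomial K :=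
  ∑ i : Fin n, Polynomial.C (a i) * Polynomial.X ^ (σ ^ (i : ℕ))

/-- Evaluation of a `q ^ s`-polynomial as an `F`-linear transformation of `K`,
where `F` is the field with `q` elements. -/
noncomputable def sigmaLin (F : Type*) {K : Type*} [Field F] [Finite F] [Field K] [Algebra F K]
    {n : ℕ} (s : ℕ) (a : Fin n → K) : K →ₗ[F] K where
  toFun x := (sigmaPoly (Nat.card F ^ s) a).eval x
  map_add' x y := by
    have := Fintype.ofFinite F
    have h : ∀ k : ℕ, (x + y) ^ (Nat.card F ^ k) =
        x ^ (Nat.card F ^ k) + y ^ (Nat.card F ^ k) := by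
      intro k
      obtain ⟨p, hp⟩ := CharP.exists F
      obtain ⟨e, hpr, hc⟩ := FiniteField.card F p
      have : Fact p.Prime := ⟨hpr⟩
      have : CharP K p := charP_of_injective_algebraMap (algebraMap F K).injective p
      rw [Nat.card_eq_fintype_card, hc, ← pow_mul]
      exact add_pow_char_pow x y p _
    simp only [sigmaPoly, Polynomial.eval_finsetSum,
      Polynomial.eval_mul, Polynomial.eval_C, Polynomial.eval_pow, Polynomial.eval_X]
    rw [← Finset.sum_add_distrib]
    refine Finset.sum_congr rfl fun i _ => ?_
    rw [← pow_mul, h, mul_add]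
  map_smul' c x := by
    have := Fintype.ofFinite F
    have h : ∀ k : ℕ, c ^ (Nat.card F ^ k) = c := by
      intro k
      rw [Nat.card_eq_fintype_card]
      exact FiniteField.pow_card_pow k c
    simp only [sigmaPoly, Polynomial.eval_finsetSum,
      Polynomial.eval_mul, Polynomial.eval_C, Polynomial.eval_pow, Polynomial.eval_X, RingHom.id_apply]
    rw [Finset.smul_sum]
    refine Finset.sum_congr rfl fun i _ => ?_
    rw [← pow_mul, smul_pow, h, mul_smul_comm]

/-- The Dickson matrix of `∑ i, a i * x ^ (σ ^ i)`: its `(i, j)` entry is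
`a (j - i) ^ (σ ^ i)`, with `j - i` taken modulo `n` (rows and columns indexed from `0`). -/
def sigmaDickson {K : Type*} [Field K] {n : ℕ} (σ : ℕ) (a : Fin n → K) :
    Matrix (Fin n) (Fin n) K :=
  Matrix.of fun i j => a (j - i) ^ (σ ^ (i : ℕ))

/-- The `(n - m) × (n - m)` matrix left after removing the first `m` columns and the last `m` rows
of the Dickson matrix. -/
def sigmaDicksonSub {K : Type*} [Field K] {n : ℕ} (σ : ℕ) (a : Fin n → K) (m : ℕ) :
    Matrix (Fin (n - m)) (Fin (n - m)) K :=
  (sigmaDickson σ a).submatrix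
    (fun i => ⟨(i : ℕ), by have := i.isLt; omega⟩)
    (fun j => ⟨m + (j : ℕ), by have := j.isLt; omega⟩)

/-- `J` consists of `m` integers of `{0, …, n - 1}` that are consecutive modulo `n`. -/
def IsConsecutiveMod {n : ℕ} (m : ℕ) (J : Finset (Fin n)) : Prop :=
  J.card = m ∧ ∃ b : ℕ, ∀ j : Fin n, j ∈ J ↔ ∃ t < m, (j : ℕ) = (b + t) % n

/-- The matrix left after removing the rows with indices in `J` and the columns with indices in
`L`; the remaining rows and columns keep their order. -/
def removeRowsCols {R : Type*} {n m : ℕ} (A : Matrix (Fin n) (Fin n) R) (J L : Finset (Fin n))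
    (hJ : J.card = m) (hL : L.card = m) : Matrix (Fin (n - m)) (Fin (n - m)) R :=
  A.submatrix
    (Jᶜ.orderEmbOfFin (by rw [Finset.card_compl, Fintype.card_fin, hJ]))
    (Lᶜ.orderEmbOfFin (by rw [Finset.card_compl, Fintype.card_fin, hL]))

/-! Let `τ` be `x ↦ x ^ σ`; since `gcd(s, n) = 1`, its fixed field is `F`. The key fact is that a
nonzero combination of `m` powers of `τ`, with exponents consecutive modulo `n`, kills no subspace
of dimension `m`. A row vector `v` times the Dickson matrix gives the coefficients of `v ∘ f`. Let
`r` be the rank of `f`. For a minor of size above `r`, some nonzero `v` supported on its rows kills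
the range of `f`, so `v ∘ f = 0` and the rows are dependent. For a minor of size `r` on cyclically
consecutive rows and columns, a row relation `v` makes `v ∘ f` live on `n - r = dim ker f`
consecutive exponents while killing `ker f`, so `v ∘ f = 0`; then `v` kills the range, of dimension
`r`, so `v = 0`. Both parts follow. -/

/-! ### Zeros of skew polynomials in `τ` -/

section SkewPolynomial

variable {F K : Type*} [Field F] [Field K] [Algebra F K]

/-- A nonzero combination of `1, τ, …, τ ^ (m - 1)` has kernel of dimension less than `m`, when the
fixed field of `τ` is `F`. -/
theorem eq_zero_of_sum_pow_apply_eq_zero [FiniteDimensional F K] (τ : K ≃ₐ[F] K)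
    (hfix : ∀ x : K, τ x = x → ∃ y : F, algebraMap F K y = x) (m : ℕ) :
    ∀ (c : ℕ → K) (W : Submodule F K), m ≤ Module.finrank F W →
      (∀ x ∈ W, ∑ t ∈ Finset.range m, c t * (τ ^ t) x = 0) → ∀ t < m, c t = 0 := by
  induction m with
  | zero => intro c W _ _ t ht; omega
  | succ m ih =>
    intro c W hW h
    have hne : W ≠ ⊥ := by
      rintro rfl
      simp at hW
    obtain ⟨x₀, hx₀, hx₀ne⟩ := Submodule.exists_mem_ne_zero_of_ne_bot hne
    -- Rescaling by `x₀` makes `1` a zero of `∑ d t * τ ^ t`, which therefore equals `(∑ e t * τ ^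
    -- t) ∘ (τ - 1)`, with one exponent fewer.
    set d : ℕ → K := fun t => c t * (τ ^ t) x₀ with hd
    set e : ℕ → K := fun t => -∑ u ∈ Finset.range (t + 1), d u with he
    have hsum : ∑ t ∈ Finset.range (m + 1), d t = 0 := h x₀ hx₀
    have hτx₀ : ∀ t : ℕ, (τ ^ t) x₀ ≠ 0 := fun t =>
      (map_ne_zero_iff _ (τ ^ t).injective).mpr hx₀ne
    -- summation by parts
    have habel : ∀ (k : ℕ) (y : K), ∑ t ∈ Finset.range k, e t * (τ ^ t) (τ y - y) =
        ∑ t ∈ Finset.range (k + 1), d t * (τ ^ t) y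
          - (∑ t ∈ Finset.range (k + 1), d t) * (τ ^ k) y := by
      intro k y
      induction k with
      | zero => simp
      | succ k ihk =>
        rw [Finset.sum_range_succ, ihk, Finset.sum_range_succ _ (k + 1),
          Finset.sum_range_succ d (k + 1), map_sub, ← AlgEquiv.mul_apply, ← pow_succ, he]
        ring
    set ψ : K →ₗ[F] K := (τ.toLinearMap - LinearMap.id) ∘ₗ LinearMap.mulLeft F x₀⁻¹ with hψ
    have hψ_apply : ∀ x, ψ x = τ (x₀⁻¹ * x) - x₀⁻¹ * x := fun x => rfl
    set φ : W →ₗ[F] K := ψ.domRestrict W with hφ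
    -- `φ x = 0` means that `τ` fixes `x / x₀`, so `x` is an `F`-multiple of `x₀`: passing to the
    -- range of `φ` loses at most one dimension.
    have hker : Module.finrank F (LinearMap.ker φ) ≤ 1 := by
      refine finrank_le_one (⟨⟨x₀, hx₀⟩, ?_⟩ : LinearMap.ker φ) ?_
      · simp [hφ, hψ_apply, hx₀ne]
      · rintro ⟨⟨x, hx⟩, hxk⟩
        have hxk' : τ (x₀⁻¹ * x) - x₀⁻¹ * x = 0 := hxk
        obtain ⟨y, hy⟩ := hfix _ (sub_eq_zero.mp hxk')
        refine ⟨y, ?_⟩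
        ext
        simp [Algebra.smul_def, hy, mul_right_comm, hx₀ne]
    have hrank := φ.finrank_range_add_finrank_ker
    have he0 := ih e (LinearMap.range φ) (by omega) (by
      rintro _ ⟨⟨x, hx⟩, rfl⟩
      change ∑ t ∈ Finset.range m, e t * (τ ^ t) (τ (x₀⁻¹ * x) - x₀⁻¹ * x) = 0
      rw [habel, hsum, zero_mul, sub_zero, ← h x hx]
      refine Finset.sum_congr rfl fun t _ => ?_
      rw [hd]
      dsimp only
      rw [mul_assoc, ← map_mul, mul_inv_cancel_left₀ hx₀ne])
    have hpartial : ∀ t ≤ m, ∑ u ∈ Finset.range (t + 1), d u = 0 := by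
      intro t ht
      rcases ht.lt_or_eq with ht | rfl
      · exact neg_eq_zero.mp (he0 t ht)
      · exact hsum
    intro t ht
    have hdt : d t = 0 := by
      have h1 := hpartial t (by omega)
      rw [Finset.sum_range_succ] at h1
      rcases t with _ | t
      · simpa using h1
      · rwa [hpartial t (by omega), zero_add] at h1
    exact (mul_eq_zero.mp hdt).resolve_right (hτx₀ t)

theorem pow_mod_eq_of_pow_eq_one {G : Type*} [Monoid G] {τ : G} {n : ℕ} (hτ : τ ^ n = 1) (k : ℕ) :
    τ ^ (k % n) = τ ^ k := by
  conv_rhs => rw [← Nat.mod_add_div k n, pow_add, pow_mul, hτ, one_pow, mul_one]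

/-- The version of `eq_zero_of_sum_pow_apply_eq_zero` for exponents that are consecutive
modulo the order of `τ`. -/
theorem eq_zero_of_sum_pow_apply_eq_zero_of_consecutive [FiniteDimensional F K] (τ : K ≃ₐ[F] K)
    (hfix : ∀ x : K, τ x = x → ∃ y : F, algebraMap F K y = x) {n : ℕ} (hτ : τ ^ n = 1)
    {m b : ℕ} (hmn : m ≤ n) (v : Fin n → K)
    (hv : ∀ j, v j ≠ 0 → ∃ t < m, (j : ℕ) = (b + t) % n) (W : Submodule F K)
    (hW : m ≤ Module.finrank F W)
    (h : ∀ x ∈ W, ∑ j : Fin n, v j * (τ ^ (j : ℕ)) x = 0) : v = 0 := by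
  rcases Nat.eq_zero_or_pos n with rfl | hn
  · exact Subsingleton.elim _ _
  set w : ℕ → K := fun t => v ⟨(b + t) % n, Nat.mod_lt _ hn⟩ with hw
  have hwm : ∀ t < m, w t = 0 := by
    -- Replacing `W` by its image under `τ ^ b` absorbs the shift of the exponents by `b`.
    refine eq_zero_of_sum_pow_apply_eq_zero τ hfix m w (W.map (τ ^ b).toLinearMap) ?_ ?_
    · rwa [LinearEquiv.finrank_map_eq (τ ^ b).toLinearEquiv W]
    · rintro _ ⟨x, hx, rfl⟩
      rw [← h x hx]
      symm
      refine (Finset.sum_of_injOn (fun t => (⟨(b + t) % n, Nat.mod_lt _ hn⟩ : Fin n))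
        ?_ ?_ ?_ ?_).symm
      · intro t ht u hu htu
        simp only [Finset.coe_range, Set.mem_Iio] at ht hu
        have h1 : b + t ≡ b + u [MOD n] := Fin.mk.inj htu
        exact Nat.ModEq.eq_of_lt_of_lt (Nat.ModEq.add_left_cancel' b h1) (by omega) (by omega)
      · intro t _
        simp
      · intro j _ hj
        by_contra hne
        obtain ⟨t, ht, hjt⟩ := hv j fun h0 => hne (by rw [h0, zero_mul])
        exact hj ⟨t, by simpa using ht, Fin.ext hjt.symm⟩
      · intro t _
        rw [pow_mod_eq_of_pow_eq_one hτ, add_comm b t, pow_add, AlgEquiv.mul_apply, hw]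
        simp only [add_comm b t]
        rfl
  funext j
  by_contra hne
  obtain ⟨t, ht, hjt⟩ := hv j hne
  apply hne
  rw [show j = ⟨(b + t) % n, Nat.mod_lt _ hn⟩ from Fin.ext hjt]
  exact hwm t ht

/-! ### Dickson minors and the rank of `f` -/

section Dickson

variable {n : ℕ} (τ : K ≃ₐ[F] K) (a : Fin n → K) (f : K →ₗ[F] K) (D : Matrix (Fin n) (Fin n) K)

/-- Multiplying the Dickson matrix by a row vector on the left is composition of skew
polynomials. -/
theorem sum_vecMul_dickson_mul_pow_apply (hτ : τ ^ n = 1)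
    (hf : ∀ x, f x = ∑ i : Fin n, a i * (τ ^ (i : ℕ)) x)
    (hD : ∀ i j, D i j = (τ ^ (i : ℕ)) (a (j - i))) (v : Fin n → K) (x : K) :
    ∑ j : Fin n, Matrix.vecMul v D j * (τ ^ (j : ℕ)) x =
      ∑ i : Fin n, v i * (τ ^ (i : ℕ)) (f x) := by
  rcases Nat.eq_zero_or_pos n with rfl | hn
  · simp
  have : NeZero n := ⟨hn.ne'⟩
  simp only [Matrix.vecMul, dotProduct, Finset.sum_mul]
  rw [Finset.sum_comm]
  refine Finset.sum_congr rfl fun i _ => ?_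
  rw [hf, map_sum, Finset.mul_sum,
    ← (Equiv.subRight i).sum_comp fun k => v i * (τ ^ (i : ℕ)) (a k * (τ ^ (k : ℕ)) x)]
  refine Finset.sum_congr rfl fun j _ => ?_
  have hpow : (τ ^ (i : ℕ)) ((τ ^ ((j - i : Fin n) : ℕ)) x) = (τ ^ (j : ℕ)) x := by
    rw [← AlgEquiv.mul_apply, ← pow_add, ← pow_mod_eq_of_pow_eq_one hτ, ← Fin.val_add,
      add_sub_cancel]
  rw [Equiv.subRight_apply, map_mul, hpow, hD, mul_assoc]

variable [FiniteDimensional F K]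

/-- Minors of the Dickson matrix of size exceeding the rank of the map vanish. -/
theorem det_submatrix_dickson_eq_zero
    (hfix : ∀ x : K, τ x = x → ∃ y : F, algebraMap F K y = x)
    (hn : Module.finrank F K = n) (hτ : τ ^ n = 1)
    (hf : ∀ x, f x = ∑ i : Fin n, a i * (τ ^ (i : ℕ)) x)
    (hD : ∀ i j, D i j = (τ ^ (i : ℕ)) (a (j - i)))
    {k : ℕ} (hk : Module.finrank F (LinearMap.range f) < k) (r c : Fin k → Fin n)
    (hr : Function.Injective r) : (D.submatrix r c).det = 0 := by
  set B := Module.finBasis F (LinearMap.range f)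
  set N : Matrix (Fin k) (Fin (Module.finrank F (LinearMap.range f))) K :=
    Matrix.of fun i l => (τ ^ (r i : ℕ)) (B l : K) with hN
  -- `N` has more rows than columns, so some nonzero combination of the chosen powers of `τ` kills a
  -- basis of the range of `f`.
  have hker : LinearMap.ker N.vecMulLinear ≠ ⊥ := by
    apply LinearMap.ker_ne_bot_of_finrank_lt
    simpa using hk
  obtain ⟨u, hu, hune⟩ := Submodule.exists_mem_ne_zero_of_ne_bot hker
  have huB : ∀ l, ∑ i, u i * (τ ^ (r i : ℕ)) (B l : K) = 0 := fun l => congrFun hu l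
  have hvan : ∀ z : LinearMap.range f, ∑ i, u i * (τ ^ (r i : ℕ)) (z : K) = 0 := by
    intro z
    set G : LinearMap.range f →ₗ[F] K :=
      ∑ i, (LinearMap.mulLeft F (u i) ∘ₗ (τ ^ (r i : ℕ)).toLinearMap).domRestrict _ with hG
    have hGz : ∀ z, G z = ∑ i, u i * (τ ^ (r i : ℕ)) (z : K) := fun z => by
      simp [hG, LinearMap.sum_apply]
    rw [← hGz, B.ext (f₁ := G) (f₂ := 0) fun l => by rw [hGz, huB, LinearMap.zero_apply],
      LinearMap.zero_apply]
  set v : Fin n → K := Function.extend r u 0 with hv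
  have hvsum : ∀ g : Fin n → K, ∑ i, v i * g i = ∑ i, u i * g (r i) := fun g => by
    refine (Finset.sum_of_injOn r hr.injOn (fun _ _ => by simp) ?_ ?_).symm
    · intro i _ hi
      rw [hv, Function.extend_apply' _ _ _ (by simpa using hi), Pi.zero_apply, zero_mul]
    · intro i _
      rw [hv, hr.extend_apply]
  have hvD : Matrix.vecMul v D = 0 := by
    refine eq_zero_of_sum_pow_apply_eq_zero_of_consecutive (m := n) (b := 0) τ hfix hτ le_rfl _
      (fun j _ => ⟨j, j.2, by rw [zero_add, Nat.mod_eq_of_lt j.2]⟩) ⊤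
      (by rw [finrank_top, hn]) fun x _ => ?_
    rw [sum_vecMul_dickson_mul_pow_apply τ a f D hτ hf hD, hvsum fun i => (τ ^ (i : ℕ)) (f x)]
    exact hvan ⟨f x, x, rfl⟩
  refine Matrix.exists_vecMul_eq_zero_iff.mp ⟨u, hune, ?_⟩
  funext l
  exact (hvsum fun i => D i (c l)).symm.trans (congrFun hvD (c l))

/-- The minors of the Dickson matrix on cyclically consecutive rows and columns, of size the rank
of the map, do not vanish. -/
theorem det_submatrix_dickson_ne_zero
    (hfix : ∀ x : K, τ x = x → ∃ y : F, algebraMap F K y = x)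
    (hn : Module.finrank F K = n) (hτ : τ ^ n = 1)
    (hf : ∀ x, f x = ∑ i : Fin n, a i * (τ ^ (i : ℕ)) x)
    (hD : ∀ i j, D i j = (τ ^ (i : ℕ)) (a (j - i)))
    {k : ℕ} (hk : Module.finrank F (LinearMap.range f) = k) (r c : Fin k → Fin n)
    (hr : Function.Injective r) {b b' : ℕ}
    (hrows : ∀ i, ∃ t < k, (r i : ℕ) = (b + t) % n)
    (hcols : ∀ j, j ∉ Set.range c → ∃ t < n - k, (j : ℕ) = (b' + t) % n) :
    (D.submatrix r c).det ≠ 0 := by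
  intro hdet
  obtain ⟨u, hune, hu⟩ := Matrix.exists_vecMul_eq_zero_iff.mpr hdet
  have hrank := f.finrank_range_add_finrank_ker
  set v : Fin n → K := Function.extend r u 0 with hv
  have hvsum : ∀ g : Fin n → K, ∑ i, v i * g i = ∑ i, u i * g (r i) := fun g => by
    refine (Finset.sum_of_injOn r hr.injOn (fun _ _ => by simp) ?_ ?_).symm
    · intro i _ hi
      rw [hv, Function.extend_apply' _ _ _ (by simpa using hi), Pi.zero_apply, zero_mul]
    · intro i _
      rw [hv, hr.extend_apply]
  have hcomp := sum_vecMul_dickson_mul_pow_apply τ a f D hτ hf hD v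
  -- The relation makes `v ∘ f` vanish at the columns kept, leaving `n - k = dim ker f` consecutive
  -- exponents.
  have hvD : Matrix.vecMul v D = 0 := by
    refine eq_zero_of_sum_pow_apply_eq_zero_of_consecutive (m := n - k) (b := b') τ hfix hτ
      (Nat.sub_le _ _) _ (fun j hj => hcols j ?_) (LinearMap.ker f) (by omega) fun x hx => ?_
    · rintro ⟨l, rfl⟩
      exact hj ((hvsum fun i => D i (c l)).trans (congrFun hu l))
    · rw [hcomp, LinearMap.mem_ker.mp hx]
      simp
  have hv0 : v = 0 := by
    refine eq_zero_of_sum_pow_apply_eq_zero_of_consecutive (m := k) (b := b) τ hfix hτ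
      (by omega) _ (fun j hj => ?_) (LinearMap.range f) hk.ge ?_
    · by_cases hjr : ∃ i, r i = j
      · obtain ⟨i, rfl⟩ := hjr
        exact hrows i
      · exact absurd (Function.extend_apply' _ _ _ hjr) hj
    · rintro _ ⟨x, rfl⟩
      rw [← hcomp, hvD]
      simp
  apply hune
  funext i
  rw [← hr.extend_apply u 0 i, ← hv, hv0]
  rfl

end Dickson

end SkewPolynomial

/-! ### Cyclic intervals, the Frobenius, and the conclusion -/

theorem IsConsecutiveMod.exists_of_notMem {n m : ℕ} {J : Finset (Fin n)}
    (hJ : IsConsecutiveMod m J) : ∃ b : ℕ, ∀ j ∉ J, ∃ t < n - m, (j : ℕ) = (b + t) % n := by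
  obtain ⟨hcard, b, hb⟩ := hJ
  have hmn : m ≤ n := by
    rw [← hcard]
    simpa using J.card_le_univ
  refine ⟨b + m, fun j hj => ?_⟩
  have hj' : ∀ t < m, (j : ℕ) ≠ (b + t) % n := fun t ht h => hj ((hb j).mpr ⟨t, ht, h⟩)
  have hn : 0 < n := j.pos
  -- `d` is the cyclic offset of `j` from `b`; reducing `b` first keeps the natural subtraction from
  -- truncating.
  set d := (j + (n - b % n)) % n with hd
  have hdj : (b + d) % n = j := by
    have hbn := Nat.mod_lt b hn
    rw [hd, Nat.add_mod_mod, Nat.add_mod, Nat.add_mod_mod]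
    rw [show b % n + (j + (n - b % n)) = j + n by omega, Nat.add_mod_right, Nat.mod_eq_of_lt j.2]
  have hdm : m ≤ d := by
    by_contra hlt
    exact hj' d (by omega) hdj.symm
  have hdn : d < n := Nat.mod_lt _ hn
  exact ⟨d - m, by omega, by rw [show b + m + (d - m) = b + d by omega, hdj]⟩

/-- Under the Frobenius, `x` has the coprime periods `s` and `[K : F]`, hence period `1`; the
Frobenius generates the Galois group. -/
theorem exists_algebraMap_eq_of_frobenius_pow_apply_eq {F K : Type*} [Field F] [Fintype F]
    [Field K] [Finite K] [Algebra F K] {s : ℕ} (hs : Nat.gcd s (Module.finrank F K) = 1) {x : K}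
    (hx : (FiniteField.frobeniusAlgEquivOfAlgebraic F K ^ s) x = x) :
    ∃ y : F, algebraMap F K y = x := by
  set φ := FiniteField.frobeniusAlgEquivOfAlgebraic F K with hφ
  have hn : φ ^ Module.finrank F K = 1 := by
    rw [← FiniteField.orderOf_frobeniusAlgEquivOfAlgebraic F K]
    exact pow_orderOf_eq_one φ
  have h1 : Function.IsPeriodicPt φ s x := by
    rw [Function.IsPeriodicPt, ← AlgEquiv.coe_pow]; exact hx
  have h2 : Function.IsPeriodicPt φ (Module.finrank F K) x := by
    rw [Function.IsPeriodicPt, ← AlgEquiv.coe_pow, hn]; rfl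
  have h3 : φ x = x := by
    have := h1.gcd h2
    rwa [hs] at this
  refine (IsGalois.mem_bot_iff_fixed (F := F) (E := K) x).mpr fun g => ?_
  obtain ⟨k, rfl⟩ := (FiniteField.bijective_frobeniusAlgEquivOfAlgebraic_pow F K).2 g
  rw [AlgEquiv.coe_pow]
  exact Function.iterate_fixed h3 _

theorem corollary8 {F K : Type*} [Field F] [Field K] [Finite F] [Finite K] [Algebra F K]
    (q n s : ℕ) (hq : Nat.card F = q) (hn : Module.finrank F K = n) (hs : Nat.gcd s n = 1)
    (a : Fin n → K) :
    (∀ μ : ℕ, Module.finrank F (LinearMap.ker (sigmaLin F s a)) = μ ↔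
      (∀ m < μ, (sigmaDicksonSub (q ^ s) a m).det = 0) ∧ (sigmaDicksonSub (q ^ s) a μ).det ≠ 0) ∧
    (∀ m ≤ Module.finrank F (LinearMap.ker (sigmaLin F s a)), ∀ J L : Finset (Fin n),
      ∀ (hJ : IsConsecutiveMod m J) (hL : IsConsecutiveMod m L),
        ((removeRowsCols (sigmaDickson (q ^ s) a) J L hJ.1 hL.1).det = 0 ↔
          (sigmaDicksonSub (q ^ s) a m).det = 0)) := by
  have := Fintype.ofFinite F
  have : FiniteDimensional F K := Module.Finite.of_finite
  set τ : K ≃ₐ[F] K := FiniteField.frobeniusAlgEquivOfAlgebraic F K ^ s with hτdef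
  have hfix : ∀ x : K, τ x = x → ∃ y : F, algebraMap F K y = x := fun x hx =>
    exists_algebraMap_eq_of_frobenius_pow_apply_eq (hn ▸ hs) hx
  have hτ : τ ^ n = 1 := by
    rw [hτdef, ← pow_mul, mul_comm, pow_mul, ← hn,
      ← FiniteField.orderOf_frobeniusAlgEquivOfAlgebraic F K, pow_orderOf_eq_one, one_pow]
  have hτpow : ∀ (i : ℕ) (x : K), (τ ^ i) x = x ^ ((q ^ s) ^ i) := by
    intro i x
    rw [hτdef, ← pow_mul, AlgEquiv.coe_pow, FiniteField.coe_frobeniusAlgEquivOfAlgebraic_iterate,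
      ← pow_mul, ← hq, Nat.card_eq_fintype_card]
  set f := sigmaLin F s a with hfdef
  have hf : ∀ x, f x = ∑ i : Fin n, a i * (τ ^ (i : ℕ)) x := by
    intro x
    change (sigmaPoly (Nat.card F ^ s) a).eval x = _
    simp only [sigmaPoly, Polynomial.eval_finsetSum, Polynomial.eval_mul, Polynomial.eval_C,
      Polynomial.eval_pow, Polynomial.eval_X, hτpow, hq]
  have hD : ∀ i j, sigmaDickson (q ^ s) a i j = (τ ^ (i : ℕ)) (a (j - i)) := by
    intro i j
    rw [hτpow]
    rfl
  have hrank := f.finrank_range_add_finrank_ker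
  rw [hn] at hrank
  have hlt : ∀ m < Module.finrank F (LinearMap.ker f), (sigmaDicksonSub (q ^ s) a m).det = 0 := by
    intro m hm
    refine det_submatrix_dickson_eq_zero τ a f _ hfix hn hτ hf hD (by omega) _ _ ?_
    intro i j hij
    exact Fin.ext (Fin.mk.inj hij)
  have hne : (sigmaDicksonSub (q ^ s) a (Module.finrank F (LinearMap.ker f))).det ≠ 0 := by
    refine det_submatrix_dickson_ne_zero (b := 0) (b' := 0) τ a f _ hfix hn hτ hf hD (by omega)
      _ _ ?_ ?_ ?_
    · intro i j hij
      exact Fin.ext (Fin.mk.inj hij)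
    · intro i
      exact ⟨i, i.2, by rw [zero_add, Nat.mod_eq_of_lt (by omega)]⟩
    · intro j hj
      refine ⟨j, ?_, by rw [zero_add, Nat.mod_eq_of_lt j.2]⟩
      by_contra hjlt
      exact hj ⟨⟨j - Module.finrank F (LinearMap.ker f), by omega⟩, Fin.ext (by simp; omega)⟩
  refine ⟨fun μ => ⟨?_, fun ⟨h1, h2⟩ => ?_⟩, fun m hm J L hJ hL => ?_⟩
  · rintro rfl
    exact ⟨hlt, hne⟩
  · rcases lt_trichotomy (Module.finrank F (LinearMap.ker f)) μ with h | h | h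
    · exact absurd (h1 _ h) hne
    · exact h
    · exact absurd (hlt _ h) h2
  -- Below the kernel dimension both minors exceed the rank in size and vanish; at equality both are
  -- nonzero.
  · rcases hm.lt_or_eq with hm | rfl
    · refine iff_of_true ?_ (hlt m hm)
      exact det_submatrix_dickson_eq_zero τ a f _ hfix hn hτ hf hD (by omega) _ _
        (Finset.orderEmbOfFin _ _).injective
    · refine iff_of_false ?_ hne
      obtain ⟨b, hb⟩ := hJ.exists_of_notMem
      obtain ⟨-, b', hb'⟩ := id hL
      refine det_submatrix_dickson_ne_zero (b := b) (b' := b') τ a f _ hfix hn hτ hf hD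
        (by omega) _ _ (Finset.orderEmbOfFin _ _).injective ?_ ?_
      · intro i
        exact hb _ (Finset.mem_compl.mp (Finset.orderEmbOfFin_mem _ _ i))
      · intro j hj
        rw [Finset.range_orderEmbOfFin, Finset.mem_coe, Finset.mem_compl, not_not] at hj
        obtain ⟨t, ht, hjt⟩ := (hb' j).mp hj
        exact ⟨t, by omega, hjt⟩
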